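/- Let $K$ be a field and let $B=K[[t]]\times K[[u]]$, with the valuation $\nu(f,g)=(\operatorname{ord} f,\operatorname{ord} g)$ and the componentwise order on values. For a subring $S\subseteq B$ put $\nu(S)=\{\nu(x): x\in S,\ \nu(x)\in\mathbb N^2\}$ and $S(\alpha)=\{r\in S:\nu(r)\ge\alpha\}$. The ring $S$ is called an Arf ring if $x^{-1}S(\alpha)$ is a ring for every $\alpha\in\nu(S)$ and every $x\in S$ with $\nu(x)=\alpha$. The Arf closure $S^*$ of $S$ is the smallest Arf subring of $B$ containing $S$. Let $\phi_1,\dots,\phi_n\in tK[[t]]$ and $\psi_1,\dots,\psi_n\in uK[[u]]$, and suppose that $$R=K[[(\phi_1(t),\psi_1(u)),\dots,(\phi_n(t),\psi_n(u))]]\subseteq B$$ (the image of $K[[x_1,\dots,x_n]]\to B$, $x_i\mapsto(\phi_i,\psi_i)$) is an algebroid curve with two branches parametrized by $t$ and $u$; that is, $B$ is the integral closure of $R$ in its total ring of fractions. Then $\nu(R^*)$ has a conductor $c=(c[1],c[2])$, i.e. a least vector $c\in\mathbb N^2$ with $c+\mathbb N^2\subseteq\nu(R^*)$. Let $\overline{\phi_i}$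 and $\overline{\psi_i}$ be obtained from $\phi_i$ and $\psi_i$ by removing all terms of degree greater than $c[1]+1$ and $c[2]+1$ respectively, and let $$\overline R=K[[(\overline{\phi_1}(t),\overline{\psi_1}(u)),\dots,(\overline{\phi_n}(t),\overline{\psi_n}(u))]].$$ Then $\overline R$ is again an algebroid curve with two branches parametrized by $t$ and $u$ (that is, $B$ is the integral closure of $\overline R$ in its total ring of fractions), and $R$ and $\overline R$ have the same Arf closure: $R^*=\overline R^{\,*}$. -/

import Mathlib

open scoped PowerSeries

noncomputable section

namespace AlgebroidCurve

/-- The ring `K[[t]] × K[[u]]` (both variables are written `X` in Lean). -/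
abbrev Ambient (K : Type*) [Field K] : Type _ := K⟦X⟧ × K⟦X⟧

/-- The valuation `ν(f, g) = (ord f, ord g)`, with the componentwise order;
a component is `⊤` exactly when the corresponding power series is zero. -/
def val {K : Type*} [Field K] (f : Ambient K) : ℕ∞ × ℕ∞ := (f.1.order, f.2.order)

/-- The value semigroup `ν(S) ⊆ ℕ²` of a subring `S`: the finite values of elements of `S`. -/
def valueSet {K : Type*} [Field K] (S : Subring (Ambient K)) : Set (ℕ × ℕ) :=
  {α | ∃ x ∈ S, val x = ((α.1 : ℕ∞), (α.2 : ℕ∞))}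

/-- `S(α) = {r ∈ S : ν(r) ≥ α}`. -/
def elementsAbove {K : Type*} [Field K] (S : Subring (Ambient K)) (α : ℕ × ℕ) :
    Set (Ambient K) :=
  {r | r ∈ S ∧ ((α.1 : ℕ∞), (α.2 : ℕ∞)) ≤ val r}

/-- `S` is an Arf ring: for every `α ∈ ν(S)` and every `x ∈ S` with `ν(x) = α`, the set
`x⁻¹ S(α)` is a ring.  Since `x` has finite value `α`, every element of `S(α)` is uniquely
`x * f` with `f ∈ K[[t]] × K[[u]]`, so that `x⁻¹ S(α) = {f : x * f ∈ S(α)}`. -/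
def IsArf {K : Type*} [Field K] (S : Subring (Ambient K)) : Prop :=
  ∀ α : ℕ × ℕ, ∀ x ∈ S, val x = ((α.1 : ℕ∞), (α.2 : ℕ∞)) →
    ∃ T : Subring (Ambient K), (T : Set (Ambient K)) = {f | x * f ∈ elementsAbove S α}

/-- The Arf closure: the smallest Arf ring containing `S` (see `isLeast_arfClosure`). -/
def arfClosure {K : Type*} [Field K] (S : Subring (Ambient K)) : Subring (Ambient K) :=
  sInf {A | IsArf A ∧ S ≤ A}

theorem isLeast_arfClosure {K : Type*} [Field K] (S : Subring (Ambient K)) :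
    IsLeast {A | IsArf A ∧ S ≤ A} (arfClosure S) := by
  refine ⟨⟨?_, le_sInf fun A hA => hA.2⟩, fun A hA => sInf_le hA⟩
  intro α x hx hval
  have hx' : ∀ A : Subring (Ambient K), IsArf A → S ≤ A → x ∈ A := fun A h1 h2 =>
    (Subring.mem_sInf.1 hx) A ⟨h1, h2⟩
  have hle : ∀ f : Ambient K, ((α.1 : ℕ∞), (α.2 : ℕ∞)) ≤ val (x * f) := by
    intro f
    rw [← hval]
    constructor
    · simp only [val, Prod.fst_mul, PowerSeries.order_mul]
      exact le_self_add
    · simp only [val, Prod.snd_mul, PowerSeries.order_mul]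
      exact le_self_add
  choose T hT using fun A : {A : Subring (Ambient K) // IsArf A ∧ S ≤ A} =>
    A.2.1 α x (hx' A.1 A.2.1 A.2.2) hval
  refine ⟨⨅ A, T A, ?_⟩
  ext f
  rw [SetLike.mem_coe, Subring.mem_iInf]
  have key : ∀ A, f ∈ T A ↔ x * f ∈ A.1 := by
    intro A
    rw [← SetLike.mem_coe, hT A]
    exact ⟨fun h => h.1, fun h => ⟨h, hle f⟩⟩
  simp only [key]
  constructor
  · intro h
    exact ⟨Subring.mem_sInf.2 fun A hA => h ⟨A, hA⟩, hle f⟩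
  · intro h A
    exact Subring.mem_sInf.1 h.1 A.1 A.2

/-- `c` is the conductor of `S ⊆ ℕ²`: the least vector with `c + ℕ² ⊆ S`
(least for the componentwise order, hence unique). -/
def IsConductor (S : Set (ℕ × ℕ)) (c : ℕ × ℕ) : Prop :=
  IsLeast {γ : ℕ × ℕ | ∀ β, γ ≤ β → β ∈ S} c

/-- A parametrization `(φ₁(t), ψ₁(u)), …, (φₙ(t), ψₙ(u))` by elements of the maximal ideal. -/
structure Parametrization (K : Type*) [Field K] (n : ℕ) where
  φ : Fin n → K⟦X⟧
  ψ : Fin n → K⟦X⟧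
  φ_zero : ∀ i, PowerSeries.constantCoeff (φ i) = 0
  ψ_zero : ∀ i, PowerSeries.constantCoeff (ψ i) = 0

namespace Parametrization

theorem hasSubst_φ {K : Type*} [Field K] {n : ℕ} (P : Parametrization K n) :
    MvPowerSeries.HasSubst P.φ :=
  MvPowerSeries.hasSubst_of_constantCoeff_zero P.φ_zero

theorem hasSubst_ψ {K : Type*} [Field K] {n : ℕ} (P : Parametrization K n) :
    MvPowerSeries.HasSubst P.ψ :=
  MvPowerSeries.hasSubst_of_constantCoeff_zero P.ψ_zero

/-- `K[[(φ₁(t), ψ₁(u)), …, (φₙ(t), ψₙ(u))]]`: the image of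
`K[[x₁, …, xₙ]] → K[[t]] × K[[u]]`, `xᵢ ↦ (φᵢ(t), ψᵢ(u))`. -/
def ring {K : Type*} [Field K] {n : ℕ} (P : Parametrization K n) : Subring (Ambient K) :=
  ((MvPowerSeries.substAlgHom (R := K) P.hasSubst_φ).prod
    (MvPowerSeries.substAlgHom (R := K) P.hasSubst_ψ)).range.toSubring

/-- `P` parametrizes an algebroid curve with two branches: `K[[t]] × K[[u]]` is the integral
closure of `R = P.ring` in its total ring of fractions.  That is, every element of
`K[[t]] × K[[u]]` is integral over `R` and is a fraction of two elements of `R` with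
denominator a non-zero-divisor (conversely `K[[t]] × K[[u]]` is integrally closed in its own
total ring of fractions).  The remaining properties (local, reduced, one-dimensional, quotient
of `K[[x₁, …, xₙ]]`) hold by construction. -/
structure IsTwoBranchCurve {K : Type*} [Field K] {n : ℕ} (P : Parametrization K n) : Prop where
  integral : ∀ f : Ambient K, IsIntegral P.ring f
  fraction : ∀ f : Ambient K, ∃ r ∈ P.ring, r ∈ nonZeroDivisors (Ambient K) ∧ r * f ∈ P.ring

/-- The truncation at `c`: remove from `φᵢ(t)` all terms of degree greater than `c[1] + 1`, and
from `ψᵢ(u)` all terms of degree greater than `c[2] + 1`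
(`PowerSeries.trunc m` keeps the terms of degree less than `m`). -/
def truncate {K : Type*} [Field K] {n : ℕ} (P : Parametrization K n) (c : ℕ × ℕ) :
    Parametrization K n where
  φ i := (PowerSeries.trunc (c.1 + 2) (P.φ i) : Polynomial K)
  ψ i := (PowerSeries.trunc (c.2 + 2) (P.ψ i) : Polynomial K)
  φ_zero i := by
    have h := P.φ_zero i
    rw [← PowerSeries.coeff_zero_eq_constantCoeff_apply] at h ⊢
    simp [PowerSeries.coeff_trunc, h]
  ψ_zero i := by
    have h := P.ψ_zero i
    rw [← PowerSeries.coeff_zero_eq_constantCoeff_apply] at h ⊢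
    simp [PowerSeries.coeff_trunc, h]

end Parametrization

end AlgebroidCurve

end

/-!
The rings involved are compared modulo the elements of value at least `d`, that is, modulo the ideal
of `K[[t]] × K[[u]]` generated by `mono K d = (t^d[1], u^d[2])`; throughout, inequalities of values
are divisibilities in `K[[t]] × K[[u]]`. Write `R = P.ring`, `A` for its Arf closure, `R'` for the
ring of the truncated parametrization and `A'` for its Arf closure.

Since the curve has two branches, `R` contains all elements of large value, and hence `ν(A)` has
a conductor `c` and `A` contains every element of value at least `c` (`exists_isConductor`,
`mem_of_mono_dvd`). In particular `A` contains the truncated generators, and `A' ⊆ A`. The converse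
follows once `A'` contains every element of value at least `c`, because then it contains the
generators of `R`. This is the heart of the matter (`Parametrization.mem_arfClosure_truncate`), and
it has two steps.

* The ring `E = A' + (elements of value ≥ c + (2, 2))` is Arf (`isArf_thicken`), and it contains
  the generators of `R`, which are congruent to those of `R'`. Hence `A ⊆ E`: modulo elements of
  value at least `c + (2, 2)`, the ring `A'` contains all elements of value at least `c`.
* Consequently `A'` contains some `y` of value `c`, and the ring `T = y⁻¹ A'(c)` exhausts
  `K[[t]] × K[[u]]` modulo `(t², u²)`. A subring with this property exhausts it modulo
  all powers of `(t, u)`. As `K[[t]] × K[[u]]` is finite over `K[[r]] ⊆ T` for a suitable `r ∈ R'`,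
  Nakayama's lemma gives `T = K[[t]] × K[[u]]` (`IsArf.mem_of_mono_dvd`).

A non-unit `r ∈ R'` of finite value exists because otherwise all generators of `R` would vanish
modulo `t^(c[1] + 2)` in the first branch, or modulo `u^(c[2] + 2)` in the second, and the elements
of `A` would be constant to that order, contrary to the definition of `c`. Finally, the fractions of
`R'` in `K[[t]] × K[[u]]` form an Arf ring, so they include `A'`; thus every element is such
a fraction, and finiteness over `K[[r]]` gives integrality.
-/

namespace AlgebroidCurve

open PowerSeries

variable {K : Type*} [Field K]

/-! ### Divisibility and order of power series -/

theorem X_pow_dvd_iff_le_order {f : K⟦X⟧} {n : ℕ} :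
    (X : K⟦X⟧) ^ n ∣ f ↔ (n : ℕ∞) ≤ f.order := by
  rw [X_pow_dvd_iff]
  exact ⟨nat_le_order f n, fun h m hm =>
    coeff_of_lt_order m (lt_of_lt_of_le (by exact_mod_cast hm) h)⟩

theorem associated_X_pow_of_order_eq {f : K⟦X⟧} {n : ℕ} (h : f.order = n) :
    Associated ((X : K⟦X⟧) ^ n) f := by
  have hf : f ≠ 0 := by rintro rfl; simp at h
  refine ⟨Unit_of_divided_by_X_pow_order f, ?_⟩
  rw [Unit_of_divided_by_X_pow_order_nonzero hf]
  conv_rhs => rw [← X_pow_order_mul_divXPowOrder (f := f)]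
  rw [h, ENat.toNat_natCast]

theorem order_eq_coe_iff {f : K⟦X⟧} {n : ℕ} : f.order = n ↔ Associated ((X : K⟦X⟧) ^ n) f := by
  refine ⟨associated_X_pow_of_order_eq, ?_⟩
  rintro ⟨u, rfl⟩
  have hu : (u : K⟦X⟧).order = 0 := order_zero_of_unit u.isUnit
  rw [order_mul, order_X_pow, hu, add_zero]

theorem exists_order_eq {f : K⟦X⟧} (hf : f ≠ 0) : ∃ n : ℕ, f.order = n :=
  ⟨f.order.toNat, (coe_toNat_order hf).symm⟩

theorem isUnit_one_add_of_constantCoeff_eq_zero {f : K⟦X⟧} (hf : constantCoeff f = 0) :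
    IsUnit (1 + f) := by
  rw [isUnit_iff_constantCoeff]; simp [hf]

theorem X_pow_dvd_sub_trunc (m : ℕ) (f : K⟦X⟧) :
    X ^ m ∣ f - ((trunc m f : Polynomial K) : K⟦X⟧) := by
  rw [X_pow_dvd_iff]
  intro i hi
  simp [coeff_trunc, hi]

theorem not_X_pow_dvd_X_pow_sub_C (a : ℕ) (k : K) :
    ¬ (X : K⟦X⟧) ^ (a + 2) ∣ X ^ (a + 1) - C k := by
  intro h
  have := X_pow_dvd_iff.1 h (a + 1) (by omega)
  simp [coeff_X_pow] at this

/-! ### Arf rings -/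

/-- The ring `x⁻¹ S(ν(x))`, for `x ∈ S` satisfying the Arf condition. -/
def blowup {S : Subring (Ambient K)} {x : Ambient K} (hx : x ∈ S)
    (h : ∀ p q : Ambient K, x * p ∈ S → x * q ∈ S → x * (p * q) ∈ S) : Subring (Ambient K) where
  carrier := {f | x * f ∈ S}
  mul_mem' hp hq := h _ _ hp hq
  one_mem' := by simpa using hx
  add_mem' hp hq := by simp only [Set.mem_ofPred_eq, mul_add] at *; exact S.add_mem hp hq
  zero_mem' := by simp
  neg_mem' hp := by simp only [Set.mem_ofPred_eq, mul_neg] at *; exact S.neg_mem hp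

theorem mem_blowup {S : Subring (Ambient K)} {x : Ambient K} {hx : x ∈ S}
    {h : ∀ p q : Ambient K, x * p ∈ S → x * q ∈ S → x * (p * q) ∈ S} {f : Ambient K} :
    f ∈ blowup hx h ↔ x * f ∈ S :=
  Iff.rfl

/-- The Arf condition in terms of divisibility: for `x` of finite value, an element of value at
least `ν(x)` is the same as a multiple of `x` in `K[[t]] × K[[u]]`. -/
theorem isArf_iff {S : Subring (Ambient K)} :
    IsArf S ↔ ∀ x ∈ S, x.1 ≠ 0 → x.2 ≠ 0 → ∀ p q : Ambient K, x * p ∈ S → x * q ∈ S →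
      x * (p * q) ∈ S := by
  have hle : ∀ (x f : Ambient K), val x ≤ val (x * f) := fun x f => by
    constructor <;> simp [val, order_mul]
  constructor
  · intro h x hx h1 h2 p q hp hq
    obtain ⟨a, ha⟩ := exists_order_eq h1
    obtain ⟨b, hb⟩ := exists_order_eq h2
    have hv : val x = ((((a, b) : ℕ × ℕ).1 : ℕ∞), (((a, b) : ℕ × ℕ).2 : ℕ∞)) := by
      simp [val, ha, hb]
    obtain ⟨T, hT⟩ := h (a, b) x hx hv
    have key : ∀ f, f ∈ T ↔ x * f ∈ S := fun f => by
      rw [← SetLike.mem_coe, hT]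
      exact ⟨fun h => h.1, fun h => ⟨h, hv ▸ hle x f⟩⟩
    exact (key _).1 (T.mul_mem ((key _).2 hp) ((key _).2 hq))
  · intro h α x hx hv
    have h1 : x.1 ≠ 0 := by
      intro h0; have := congrArg Prod.fst hv; simp [val, h0] at this
    have h2 : x.2 ≠ 0 := by
      intro h0; have := congrArg Prod.snd hv; simp [val, h0] at this
    refine ⟨blowup hx (h x hx h1 h2), ?_⟩
    ext f
    exact ⟨fun hf => ⟨hf, hv ▸ hle x f⟩, fun hf => hf.1⟩

theorem isArf_arfClosure (S : Subring (Ambient K)) : IsArf (arfClosure S) :=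
  (isLeast_arfClosure S).1.1

theorem le_arfClosure (S : Subring (Ambient K)) : S ≤ arfClosure S :=
  (isLeast_arfClosure S).1.2

theorem arfClosure_le {S A : Subring (Ambient K)} (hA : IsArf A) (h : S ≤ A) : arfClosure S ≤ A :=
  (isLeast_arfClosure S).2 ⟨hA, h⟩

/-- The subring `S + I` for a subring `S` and an ideal `I`. -/
def thicken {A : Type*} [CommRing A] (S : Subring A) (I : Ideal A) : Subring A :=
  (S.map (Ideal.Quotient.mk I)).comap (Ideal.Quotient.mk I)

theorem mem_thicken {A : Type*} [CommRing A] {S : Subring A} {I : Ideal A} {b : A} :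
    b ∈ thicken S I ↔ ∃ y ∈ S, b - y ∈ I := by
  simp only [thicken, Subring.mem_comap, Subring.mem_map]
  refine exists_congr fun y => and_congr_right fun _ => ?_
  rw [eq_comm, Ideal.Quotient.eq]

theorem le_thicken {A : Type*} [CommRing A] (S : Subring A) (I : Ideal A) : S ≤ thicken S I :=
  fun y hy => mem_thicken.2 ⟨y, hy, by simp⟩

theorem mem_thicken_of_mem_ideal {A : Type*} [CommRing A] (S : Subring A) {I : Ideal A} {b : A}
    (hb : b ∈ I) : b ∈ thicken S I :=
  mem_thicken.2 ⟨0, S.zero_mem, by simpa using hb⟩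

/-- The element `(t^d[1], u^d[2])`. Its multiples are the elements of value at least `d`. -/
noncomputable def mono (K : Type*) [Field K] (d : ℕ × ℕ) : Ambient K := (X ^ d.1, X ^ d.2)

theorem mono_dvd {d : ℕ × ℕ} {b : Ambient K} :
    mono K d ∣ b ↔ (X : K⟦X⟧) ^ d.1 ∣ b.1 ∧ (X : K⟦X⟧) ^ d.2 ∣ b.2 := by
  rw [mono, prod_dvd_iff]

theorem mono_add (d e : ℕ × ℕ) : mono K (d + e) = mono K d * mono K e := by
  simp [mono, pow_add]

theorem mono_dvd_mono {d e : ℕ × ℕ} (h : d ≤ e) : mono K d ∣ mono K e :=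
  mono_dvd.2 ⟨pow_dvd_pow _ h.1, pow_dvd_pow _ h.2⟩

/-! ### Greatest common divisors inside a subring -/

theorem dvd_add_of_dvd_of_not_dvd {a b : K⟦X⟧} (h : a ∣ b) (h' : ¬ b ∣ a) : a + b ∣ a := by
  obtain ⟨m, rfl⟩ := h
  have hm : constantCoeff m = 0 := by
    by_contra hm
    have : IsUnit m := by rw [isUnit_iff_constantCoeff]; exact isUnit_iff_ne_zero.2 hm
    exact h' ((this.mul_right_dvd).2 dvd_rfl)
  have hu := isUnit_one_add_of_constantCoeff_eq_zero hm
  rw [show a + a * m = a * (1 + m) by ring]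
  exact (hu.mul_right_dvd).2 dvd_rfl

theorem dvd_or_dvd (a b : K⟦X⟧) : a ∣ b ∨ b ∣ a := ValuationRing.dvd_total a b

/-- A subring is closed under greatest common divisors of `K[[t]] × K[[u]]`; on values, this is
closure under componentwise minimum. One of `x`, `y`, `x + y` always works, whatever the
residue field. -/
theorem exists_gcd_mem {S : Subring (Ambient K)} {x y : Ambient K} (hx : x ∈ S) (hy : y ∈ S) :
    ∃ z ∈ S, z ∣ x ∧ z ∣ y ∧ ∃ e e', z = e * x + e' * y := by
  by_cases hxy : x ∣ y
  · exact ⟨x, hx, dvd_rfl, hxy, 1, 0, by ring⟩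
  by_cases hyx : y ∣ x
  · exact ⟨y, hy, hyx, dvd_rfl, 0, 1, by ring⟩
  have key : x + y ∣ x := by
    rw [prod_dvd_iff] at *
    rcases dvd_or_dvd x.1 y.1 with h1 | h1 <;> rcases dvd_or_dvd x.2 y.2 with h2 | h2
    · exact absurd ⟨h1, h2⟩ hxy
    · have a1 : ¬ y.1 ∣ x.1 := fun h => hyx ⟨h, h2⟩
      have a2 : ¬ x.2 ∣ y.2 := fun h => hxy ⟨h1, h⟩
      refine ⟨dvd_add_of_dvd_of_not_dvd h1 a1, ?_⟩
      have := (dvd_add_of_dvd_of_not_dvd h2 a2).trans h2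
      rwa [add_comm] at this
    · have a1 : ¬ x.1 ∣ y.1 := fun h => hxy ⟨h, h2⟩
      have a2 : ¬ y.2 ∣ x.2 := fun h => hyx ⟨h1, h⟩
      refine ⟨?_, dvd_add_of_dvd_of_not_dvd h2 a2⟩
      have := (dvd_add_of_dvd_of_not_dvd h1 a1).trans h1
      rwa [add_comm] at this
    · exact absurd ⟨h1, h2⟩ hyx
  exact ⟨x + y, S.add_mem hx hy, key, by simpa using dvd_sub (dvd_refl (x + y)) key, 1, 1, by ring⟩

/-! ### Thickenings of Arf rings -/

/-- The comparison in one branch behind `isArf_thicken`. -/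
theorem X_pow_dvd_sub_of_congruent {d : ℕ} {x p q x' y' z' s g ξ η ζ τ ρ : K⟦X⟧}
    (hx : X ^ d ∣ x - x') (hy : X ^ d ∣ x * p - y') (hz : X ^ d ∣ x * q - z') (hs : X ^ d ∣ s)
    (hgen : ∃ e₀ e₁ e₂ e₃, g = e₀ * x' + e₁ * y' + e₂ * z' + e₃ * s)
    (hξ : x' = g * ξ) (hη : y' = g * η) (hζ : z' = g * ζ) (hτ : ξ * τ = 1 - ρ)
    (hρ : constantCoeff ξ ≠ 0 → X ^ d ∣ ρ) : X ^ d ∣ x * (p * q) - g * (η * ζ * τ) := by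
  obtain ⟨e₀, e₁, e₂, e₃, hgen⟩ := hgen
  obtain ⟨a, ha⟩ := hx
  obtain ⟨b, hb⟩ := hy
  obtain ⟨c, hc⟩ := hz
  obtain ⟨s', rfl⟩ := hs
  by_cases hdx : X ^ d ∣ x
  · obtain ⟨w, rfl⟩ := hdx
    have hgd : X ^ d ∣ g := by
      refine ⟨e₀ * (w - a) + e₁ * (w * p - b) + e₂ * (w * q - c) + e₃ * s', ?_⟩
      rw [hgen]
      linear_combination (-e₀) * ha - e₁ * hb - e₂ * hc
    exact dvd_sub ((Dvd.intro _ rfl).mul_right _) (hgd.mul_right _)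
  · obtain ⟨m, hm⟩ : x ∣ X ^ d := (dvd_or_dvd _ _).resolve_right hdx
    have hx0 : x ≠ 0 := by rintro rfl; simp at hdx
    have hm0 : constantCoeff m = 0 := by
      by_contra h0
      have hu : IsUnit m := by rw [isUnit_iff_constantCoeff]; exact isUnit_iff_ne_zero.2 h0
      exact hdx (by rw [hm]; exact (hu.mul_right_dvd).2 dvd_rfl)
    have hu : IsUnit (1 + (- m * a)) := isUnit_one_add_of_constantCoeff_eq_zero (by simp [hm0])
    have hx' : x' = x * (1 + (- m * a)) := by
      linear_combination (-1 : K⟦X⟧) * ha - a * hm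
    have hy' : y' = x * (p - m * b) := by linear_combination (-1 : K⟦X⟧) * hb - b * hm
    have hz' : z' = x * (q - m * c) := by linear_combination (-1 : K⟦X⟧) * hc - c * hm
    -- `x'` and `g` differ by a unit, because `x` divides `y'`, `z'` and `s`
    have hξu : IsUnit ξ := by
      have h1 : x * ((1 + (- m * a)) - (e₀ * (1 + (- m * a)) + e₁ * (p - m * b) +
          e₂ * (q - m * c) + e₃ * (m * s')) * ξ) = 0 := by
        have : x' = (e₀ * x' + e₁ * y' + e₂ * z' + e₃ * (X ^ d * s')) * ξ := by
          rw [← hgen]; exact hξ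
        rw [hx', hy', hz', hm] at this
        linear_combination this
      have h2 := (mul_eq_zero.1 h1).resolve_left hx0
      rw [sub_eq_zero] at h2
      rw [h2] at hu
      exact isUnit_of_mul_isUnit_right hu
    obtain ⟨r, hr⟩ := hρ (by
      rw [isUnit_iff_constantCoeff] at hξu
      exact hξu.ne_zero)
    have e1 : x' * (g * (η * ζ * τ)) = y' * z' * (1 - ρ) := by
      rw [hξ, hη, hζ, ← hτ]; ring
    have key : x * ((1 + (-m * a)) * (x * (p * q) - g * (η * ζ * τ))) =
        x * (X ^ d * (-a * (p * q) + b * q + p * c - m * b * c +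
          (p - m * b) * (q - m * c) * r * x)) := by
      rw [← mul_assoc, ← hx', mul_sub, e1, hx', hy', hz', hr, hm]
      ring
    exact (hu.dvd_mul_left).1 (Dvd.intro _ (mul_left_cancel₀ hx0 key).symm)

/-- If `S` is an Arf ring containing `K` and an element of finite value at least `d`, then adding
all elements of value at least `d` to `S` gives an Arf ring.

Given `x`, `xp`, `xq` in the sum, choose representatives `x'`, `y'`, `z'` in `S`. In a branch where
`ν(x) ≥ d` the value of `x'` can exceed those of `y'` and `z'`, so that one cannot divide by `x'`;
instead one divides by a greatest common divisor `g ∈ S` of `x'`, `y'`, `z'` and an element of value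
at least `d`, and inverts `x' / g` approximately, in the branches where it is a unit, by a
polynomial in `x' / g`. -/
theorem isArf_thicken {S : Subring (Ambient K)} (hS : IsArf S)
    (hK : ∀ k, algebraMap K (Ambient K) k ∈ S) {d : ℕ × ℕ} {s : Ambient K} (hs : s ∈ S)
    (hs1 : s.1 ≠ 0) (hs2 : s.2 ≠ 0) (hds : mono K d ∣ s) :
    IsArf (thicken S (Ideal.span {mono K d})) := by
  rw [isArf_iff]
  intro x hx _ _ p q hp hq
  obtain ⟨x', hx', hxx⟩ := mem_thicken.1 hx
  obtain ⟨y', hy', hyy⟩ := mem_thicken.1 hp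
  obtain ⟨z', hz', hzz⟩ := mem_thicken.1 hq
  obtain ⟨g₁, hg₁, hg₁x, hg₁y, a₁, b₁, h₁⟩ := exists_gcd_mem hx' hy'
  obtain ⟨g₂, hg₂, hg₂g, hg₂z, a₂, b₂, h₂⟩ := exists_gcd_mem hg₁ hz'
  obtain ⟨g, hg, hgg, hgs, a₃, b₃, h₃⟩ := exists_gcd_mem hg₂ hs
  have hg1 : g.1 ≠ 0 := fun h => hs1 (by
    obtain ⟨w, rfl⟩ := hgs; simp [h])
  have hg2 : g.2 ≠ 0 := fun h => hs2 (by
    obtain ⟨w, rfl⟩ := hgs; simp [h])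
  have hgen : g = a₃ * a₂ * a₁ * x' + a₃ * a₂ * b₁ * y' + a₃ * b₂ * z' + b₃ * s := by
    rw [h₃, h₂, h₁]; ring
  obtain ⟨ξ, hξ⟩ := hgg.trans (hg₂g.trans hg₁x)
  obtain ⟨η, hη⟩ := hgg.trans (hg₂g.trans hg₁y)
  obtain ⟨ζ, hζ⟩ := hgg.trans hg₂z
  set T := blowup hg (isArf_iff.1 hS g hg hg1 hg2) with hT
  have hKT : ∀ k, algebraMap K (Ambient K) k ∈ T := fun k =>
    mem_blowup.2 (S.mul_mem hg (hK k))
  have hξT : ξ ∈ T := mem_blowup.2 (hξ ▸ hx')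
  have hηT : η ∈ T := mem_blowup.2 (hη ▸ hy')
  have hζT : ζ ∈ T := mem_blowup.2 (hζ ▸ hz')
  -- the factors of `σ` kill the constant coefficients of `ξ`; where such a coefficient vanishes,
  -- its junk inverse `0` makes the factor equal to `1`
  set l₁ := algebraMap K (Ambient K) (constantCoeff ξ.1)⁻¹ with hl₁
  set l₂ := algebraMap K (Ambient K) (constantCoeff ξ.2)⁻¹ with hl₂
  set σ : Ambient K := (1 - l₁ * ξ) * (1 - l₂ * ξ) with hσ
  set N := max d.1 d.2 with hN
  set τ : Ambient K := (l₁ + l₂ - l₁ * l₂ * ξ) * ∑ i ∈ Finset.range N, σ ^ i with hτ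
  have hl₁T : l₁ ∈ T := hKT _
  have hl₂T : l₂ ∈ T := hKT _
  have hσT : σ ∈ T := T.mul_mem (T.sub_mem T.one_mem (T.mul_mem hl₁T hξT))
    (T.sub_mem T.one_mem (T.mul_mem hl₂T hξT))
  have hτT : τ ∈ T := T.mul_mem (T.sub_mem (T.add_mem hl₁T hl₂T)
    (T.mul_mem (T.mul_mem hl₁T hl₂T) hξT)) (T.sum_mem fun i _ => T.pow_mem hσT i)
  have hξτ : ξ * τ = 1 - σ ^ N := by
    rw [← mul_neg_geom_sum, hτ, hσ]; ring
  refine mem_thicken.2 ⟨g * (η * ζ * τ), mem_blowup.1 (T.mul_mem (T.mul_mem hηT hζT) hτT), ?_⟩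
  rw [Ideal.mem_span_singleton, mono_dvd] at hxx hyy hzz ⊢
  rw [mono_dvd] at hds
  constructor
  · refine X_pow_dvd_sub_of_congruent hxx.1 hyy.1 hzz.1 hds.1
      ⟨_, _, _, _, congrArg Prod.fst hgen⟩ (congrArg Prod.fst hξ) (congrArg Prod.fst hη)
      (congrArg Prod.fst hζ) (congrArg Prod.fst hξτ) fun h0 => ?_
    refine (pow_dvd_pow X (le_max_left d.1 d.2)).trans (pow_dvd_pow_of_dvd ?_ N)
    rw [X_dvd_iff]
    simp [hσ, hl₁, h0]
  · refine X_pow_dvd_sub_of_congruent hxx.2 hyy.2 hzz.2 hds.2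
      ⟨_, _, _, _, congrArg Prod.snd hgen⟩ (congrArg Prod.snd hξ) (congrArg Prod.snd hη)
      (congrArg Prod.snd hζ) (congrArg Prod.snd hξτ) fun h0 => ?_
    refine (pow_dvd_pow X (le_max_right d.1 d.2)).trans (pow_dvd_pow_of_dvd ?_ N)
    rw [X_dvd_iff]
    simp [hσ, hl₂, h0]

theorem exists_X_pow_dvd_mul_sub_C {a : ℕ} {x p q : K⟦X⟧} {k l m : K} (hx : X ^ a ∣ x - C k)
    (hp : X ^ a ∣ x * p - C l) (hq : X ^ a ∣ x * q - C m) :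
    ∃ r, X ^ a ∣ x * (p * q) - C r := by
  rcases eq_or_ne k 0 with rfl | hk
  · refine ⟨0, ?_⟩
    rw [map_zero, sub_zero] at *
    exact hx.mul_right _
  · refine ⟨k⁻¹ * (l * m), ?_⟩
    have e : C k⁻¹ * C k = (1 : K⟦X⟧) := by rw [← map_mul, inv_mul_cancel₀ hk, map_one]
    have : x * (p * q) - C (k⁻¹ * (l * m)) = C k⁻¹ * ((x * p - C l) * (x * q) +
        C l * (x * q - C m) - (x - C k) * (x * (p * q))) := by
      rw [map_mul, map_mul]; linear_combination (- x * (p * q)) * e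
    rw [this]
    exact ((((hp.mul_right _).add (hq.mul_left _)).sub (hx.mul_right _)).mul_left _)

/-- The elements whose component in the first branch is congruent to a constant modulo `X ^ a`
form an Arf ring. -/
theorem isArf_thicken_constants_fst (a : ℕ) :
    IsArf (thicken (algebraMap K (Ambient K)).range
      ((Ideal.span {X ^ a}).comap (RingHom.fst K⟦X⟧ K⟦X⟧))) := by
  rw [isArf_iff]
  intro x hx _ _ p q hp hq
  obtain ⟨_, ⟨k, rfl⟩, hk⟩ := mem_thicken.1 hx
  obtain ⟨_, ⟨l, rfl⟩, hl⟩ := mem_thicken.1 hp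
  obtain ⟨_, ⟨m, rfl⟩, hm⟩ := mem_thicken.1 hq
  rw [Ideal.mem_comap, Ideal.mem_span_singleton] at hk hl hm
  obtain ⟨r, hr⟩ := exists_X_pow_dvd_mul_sub_C (k := k) (l := l) (m := m) hk hl hm
  exact mem_thicken.2 ⟨_, ⟨r, rfl⟩, by rwa [Ideal.mem_comap, Ideal.mem_span_singleton]⟩

theorem isArf_thicken_constants_snd (a : ℕ) :
    IsArf (thicken (algebraMap K (Ambient K)).range
      ((Ideal.span {X ^ a}).comap (RingHom.snd K⟦X⟧ K⟦X⟧))) := by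
  rw [isArf_iff]
  intro x hx _ _ p q hp hq
  obtain ⟨_, ⟨k, rfl⟩, hk⟩ := mem_thicken.1 hx
  obtain ⟨_, ⟨l, rfl⟩, hl⟩ := mem_thicken.1 hp
  obtain ⟨_, ⟨m, rfl⟩, hm⟩ := mem_thicken.1 hq
  rw [Ideal.mem_comap, Ideal.mem_span_singleton] at hk hl hm
  obtain ⟨r, hr⟩ := exists_X_pow_dvd_mul_sub_C (k := k) (l := l) (m := m) hk hl hm
  exact mem_thicken.2 ⟨_, ⟨r, rfl⟩, by rwa [Ideal.mem_comap, Ideal.mem_span_singleton]⟩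

/-! ### Fractions -/

theorem mem_nonZeroDivisors_iff {x : Ambient K} :
    x ∈ nonZeroDivisors (Ambient K) ↔ x.1 ≠ 0 ∧ x.2 ≠ 0 := by
  rw [mem_nonZeroDivisors_iff_right]
  constructor
  · intro h
    constructor
    · intro h0
      have := h (1, 0) (by ext1 <;> simp [h0])
      simpa using congrArg Prod.fst this
    · intro h0
      have := h (0, 1) (by ext1 <;> simp [h0])
      simpa using congrArg Prod.snd this
  · rintro ⟨h1, h2⟩ y hy
    ext1
    · exact (mul_eq_zero.1 (congrArg Prod.fst hy)).resolve_right h1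
    · exact (mul_eq_zero.1 (congrArg Prod.snd hy)).resolve_right h2

/-- The elements of `K[[t]] × K[[u]]` that lie in the total ring of fractions of `S`: those that
become elements of `S` after multiplication by some element of `S` of finite value. -/
def fractions (S : Subring (Ambient K)) : Subring (Ambient K) where
  carrier := {b | ∃ r ∈ S, r ∈ nonZeroDivisors (Ambient K) ∧ r * b ∈ S}
  mul_mem' := by
    rintro a b ⟨r, hr, hr0, hra⟩ ⟨s, hs, hs0, hsb⟩
    refine ⟨r * s, S.mul_mem hr hs, mul_mem hr0 hs0, ?_⟩
    rw [show r * s * (a * b) = r * a * (s * b) by ring]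
    exact S.mul_mem hra hsb
  one_mem' := ⟨1, S.one_mem, one_mem _, by simp⟩
  add_mem' := by
    rintro a b ⟨r, hr, hr0, hra⟩ ⟨s, hs, hs0, hsb⟩
    refine ⟨r * s, S.mul_mem hr hs, mul_mem hr0 hs0, ?_⟩
    rw [show r * s * (a + b) = s * (r * a) + r * (s * b) by ring]
    exact S.add_mem (S.mul_mem hs hra) (S.mul_mem hr hsb)
  zero_mem' := ⟨1, S.one_mem, one_mem _, by simp⟩
  neg_mem' := by
    rintro a ⟨r, hr, hr0, hra⟩
    exact ⟨r, hr, hr0, by rw [mul_neg]; exact S.neg_mem hra⟩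

theorem mem_fractions {S : Subring (Ambient K)} {b : Ambient K} :
    b ∈ fractions S ↔ ∃ r ∈ S, r ∈ nonZeroDivisors (Ambient K) ∧ r * b ∈ S :=
  Iff.rfl

theorem le_fractions (S : Subring (Ambient K)) : S ≤ fractions S :=
  fun b hb => ⟨1, S.one_mem, one_mem _, by simpa using hb⟩

theorem mem_fractions_of_mul_mem {S : Subring (Ambient K)} {x b : Ambient K}
    (hx : x ∈ fractions S) (hx0 : x ∈ nonZeroDivisors (Ambient K)) (hxb : x * b ∈ fractions S) :
    b ∈ fractions S := by
  obtain ⟨r, hr, hr0, hrx⟩ := hx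
  obtain ⟨s, hs, hs0, hsb⟩ := hxb
  refine ⟨s * (r * x), S.mul_mem hs hrx, mul_mem hs0 (mul_mem hr0 hx0), ?_⟩
  rw [show s * (r * x) * b = r * (s * (x * b)) by ring]
  exact S.mul_mem hr hsb

theorem isArf_fractions (S : Subring (Ambient K)) : IsArf (fractions S) := by
  rw [isArf_iff]
  intro x hx h1 h2 p q hp hq
  refine mem_fractions_of_mul_mem hx (mem_nonZeroDivisors_iff.2 ⟨h1, h2⟩) ?_
  rw [show x * (x * (p * q)) = x * p * (x * q) by ring]
  exact mul_mem hp hq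

/-! ### The conductor -/

theorem mem_valueSet {S : Subring (Ambient K)} {α : ℕ × ℕ} :
    α ∈ valueSet S ↔ ∃ x ∈ S, Associated (X ^ α.1) x.1 ∧ Associated (X ^ α.2) x.2 := by
  simp only [valueSet, Set.mem_ofPred_eq, val, Prod.mk.injEq, order_eq_coe_iff]

theorem inf_mem_valueSet {S : Subring (Ambient K)} {α β : ℕ × ℕ} (hα : α ∈ valueSet S)
    (hβ : β ∈ valueSet S) : α ⊓ β ∈ valueSet S := by
  have aux : ∀ {x y z e e' : K⟦X⟧} {a b : ℕ}, Associated (X ^ a) x → Associated (X ^ b) y →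
      z ∣ x → z ∣ y → z = e * x + e' * y → Associated (X ^ (min a b)) z := by
    rintro x y z e e' a b hx hy hzx hzy rfl
    refine associated_of_dvd_dvd (dvd_add ?_ ?_) ?_
    · exact ((pow_dvd_pow _ (min_le_left _ _)).trans hx.dvd).mul_left _
    · exact ((pow_dvd_pow _ (min_le_right _ _)).trans hy.dvd).mul_left _
    · rcases min_choice a b with h | h <;> rw [h]
      · exact hzx.trans hx.symm.dvd
      · exact hzy.trans hy.symm.dvd
  obtain ⟨x, hx, hx1, hx2⟩ := mem_valueSet.1 hα
  obtain ⟨y, hy, hy1, hy2⟩ := mem_valueSet.1 hβ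
  obtain ⟨z, hz, hzx, hzy, e, e', h⟩ := exists_gcd_mem hx hy
  rw [prod_dvd_iff] at hzx hzy
  exact mem_valueSet.2 ⟨z, hz, aux hx1 hy1 hzx.1 hzy.1 (congrArg Prod.fst h),
    aux hx2 hy2 hzx.2 hzy.2 (congrArg Prod.snd h)⟩

/-- A set of values closed under componentwise minimum that contains all large values has a
conductor. -/
theorem exists_isConductor {V : Set (ℕ × ℕ)} (hV : ∀ α ∈ V, ∀ β ∈ V, α ⊓ β ∈ V) {γ : ℕ × ℕ}
    (hγ : ∀ β, γ ≤ β → β ∈ V) : ∃ c, IsConductor V c := by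
  set Γ : Set (ℕ × ℕ) := {γ | ∀ β, γ ≤ β → β ∈ V} with hΓ
  have hne : Γ.Nonempty := ⟨γ, hγ⟩
  obtain ⟨a, ha, ha'⟩ := Nat.sInf_mem (hne.image Prod.fst)
  obtain ⟨b, hb, hb'⟩ := Nat.sInf_mem (hne.image Prod.snd)
  refine ⟨(a.1, b.2), fun β hβ => ?_, fun δ hδ => ⟨?_, ?_⟩⟩
  · have h := hV _ (ha (β ⊔ a) le_sup_right) _ (hb (β ⊔ b) le_sup_right)
    have h1 : a.1 ≤ β.1 := hβ.1
    have h2 : b.2 ≤ β.2 := hβ.2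
    convert h using 1
    ext
    · simp only [Prod.fst_inf, Prod.fst_sup]; omega
    · simp only [Prod.snd_inf, Prod.snd_sup]; omega
  · exact ha' ▸ Nat.sInf_le ⟨δ, hδ, rfl⟩
  · exact hb' ▸ Nat.sInf_le ⟨δ, hδ, rfl⟩

theorem exists_X_pow_succ_dvd_sub {m : ℕ} {b z : K⟦X⟧} (hz : Associated (X ^ m) z)
    (hb : X ^ m ∣ b) : ∃ k, X ^ (m + 1) ∣ b - C k * z := by
  obtain ⟨w, rfl⟩ := hz.dvd_iff_dvd_left.1 hb
  refine ⟨constantCoeff w, ?_⟩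
  rw [pow_succ, show z * w - C (constantCoeff w) * z = z * (w - C (constantCoeff w)) by ring]
  exact mul_dvd_mul hz.dvd (by rw [X_dvd_iff]; simp)

/-- A subring containing `K` and all elements of large value contains every element of value at
least `c` as soon as its value semigroup contains `c + ℕ²`. -/
theorem mem_of_mono_dvd {S : Subring (Ambient K)} (hK : ∀ k, algebraMap K (Ambient K) k ∈ S)
    {γ c : ℕ × ℕ} (hγ : ∀ b, mono K γ ∣ b → b ∈ S) (hc : ∀ β, c ≤ β → β ∈ valueSet S)
    {b : Ambient K} (hb : mono K c ∣ b) : b ∈ S := by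
  set M := max γ.1 γ.2 with hM
  have first : ∀ m (b : Ambient K), mono K c ∣ b → ∃ y ∈ S, mono K (c.1 + m, c.2) ∣ b - y := by
    intro m
    induction m with
    | zero => exact fun b hb => ⟨0, S.zero_mem, by simpa using hb⟩
    | succ m ih =>
      intro b hb
      obtain ⟨y, hy, hby⟩ := ih b hb
      obtain ⟨z, hz, hz1, hz2⟩ := mem_valueSet.1 (hc (c.1 + m, c.2) ⟨by simp, le_rfl⟩)
      rw [mono_dvd] at hby
      obtain ⟨k, hk⟩ := exists_X_pow_succ_dvd_sub hz1 hby.1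
      refine ⟨y + algebraMap K _ k * z, S.add_mem hy (S.mul_mem (hK k) hz), mono_dvd.2 ⟨?_, ?_⟩⟩
      · rw [← sub_sub]; exact hk
      · rw [← sub_sub]; exact hby.2.sub (hz2.dvd.mul_left _)
  have second : ∀ m (b : Ambient K), mono K (c.1 + M, c.2) ∣ b →
      ∃ y ∈ S, mono K (c.1 + M, c.2 + m) ∣ b - y := by
    intro m
    induction m with
    | zero => exact fun b hb => ⟨0, S.zero_mem, by simpa using hb⟩
    | succ m ih =>
      intro b hb
      obtain ⟨y, hy, hby⟩ := ih b hb
      obtain ⟨z, hz, hz1, hz2⟩ := mem_valueSet.1 (hc (c.1 + M, c.2 + m) ⟨by simp, by simp⟩)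
      rw [mono_dvd] at hby
      obtain ⟨k, hk⟩ := exists_X_pow_succ_dvd_sub hz2 hby.2
      refine ⟨y + algebraMap K _ k * z, S.add_mem hy (S.mul_mem (hK k) hz), mono_dvd.2 ⟨?_, ?_⟩⟩
      · rw [← sub_sub]; exact hby.1.sub (hz1.dvd.mul_left _)
      · rw [← sub_sub]; exact hk
  obtain ⟨y, hy, hby⟩ := first M b hb
  obtain ⟨y', hy', hby'⟩ := second M _ hby
  have h : b - y - y' ∈ S := hγ _ ((mono_dvd_mono (e := (c.1 + M, c.2 + M)) ⟨by
    simp only; omega, by simp only; omega⟩).trans hby')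
  simpa using S.add_mem (S.add_mem h hy') hy

/-! ### Finite extensions -/

theorem finite_of_forall_exists_sum {Λ B ι : Type*} [CommRing Λ] [CommRing B] [Fintype ι]
    (θ : Λ →+* B) (v : ι → B) (h : ∀ b, ∃ c : ι → Λ, b = ∑ i, θ (c i) * v i) : θ.Finite := by
  classical
  let := θ.toAlgebra
  refine ⟨⟨Finset.univ.image v, eq_top_iff.2 fun b _ => ?_⟩⟩
  obtain ⟨c, rfl⟩ := h b
  exact Submodule.sum_mem _ fun i _ =>
    Submodule.smul_mem _ (c i) (Submodule.subset_span (by simp))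

/-- Nakayama's lemma for a subring that is a submodule over a ring `Λ` of scalars. -/
theorem forall_mem_of_forall_dvd_sub {Λ B : Type*} [CommRing Λ] [CommRing B] {θ : Λ →+* B}
    (hθ : θ.Finite) {ϖ : Λ} (hϖ : ϖ ∈ (⊥ : Ideal Λ).jacobson) {T : Subring B}
    (hT : ∀ c, θ c ∈ T) (h : ∀ b, ∃ t ∈ T, θ ϖ ∣ b - t) (b : B) : b ∈ T := by
  let := θ.toAlgebra
  let N : Submodule Λ B :=
    { carrier := T
      add_mem' := T.add_mem
      zero_mem' := T.zero_mem
      smul_mem' := fun c x hx => T.mul_mem (hT c) hx }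
  have hfin : (⊤ : Submodule Λ B).FG := hθ.fg_top
  have : (⊤ : Submodule Λ B) ≤ N := by
    refine Submodule.le_of_le_smul_of_le_jacobson_bot (I := Ideal.span {ϖ}) hfin
      ((Ideal.span_singleton_le_iff_mem _).2 hϖ) fun x _ => ?_
    obtain ⟨t, ht, w, hw⟩ := h x
    refine Submodule.mem_sup.2 ⟨t, ht, ϖ • w, Submodule.smul_mem_smul
      (Ideal.mem_span_singleton_self ϖ) trivial, ?_⟩
    rw [show ϖ • w = θ ϖ * w from rfl, ← hw]
    ring
  exact this (Submodule.mem_top (x := b))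

theorem exists_common_denominator {Λ B : Type*} [CommRing Λ] [CommRing B] {θ : Λ →+* B}
    (hθ : θ.Finite) {R : Subring B} (hR : ∀ c, θ c ∈ R)
    (h : ∀ b, ∃ r ∈ R, r ∈ nonZeroDivisors B ∧ r * b ∈ R) :
    ∃ d ∈ R, d ∈ nonZeroDivisors B ∧ ∀ b, d * b ∈ R := by
  classical
  let := θ.toAlgebra
  obtain ⟨s, hs⟩ := hθ.fg_top
  choose r hr hr0 hrb using h
  refine ⟨∏ v ∈ s, r v, R.prod_mem fun v _ => hr v, prod_mem fun v _ => hr0 v, fun b => ?_⟩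
  have hb : b ∈ Submodule.span Λ (s : Set B) := hs ▸ Submodule.mem_top
  induction hb using Submodule.span_induction with
  | mem v hv =>
    rw [← Finset.mul_prod_erase s r hv, show r v * (∏ x ∈ s.erase v, r x) * v =
      r v * v * ∏ x ∈ s.erase v, r x by ring]
    exact R.mul_mem (hrb v) (R.prod_mem fun v _ => hr v)
  | zero => simp
  | add x y _ _ hx hy => rw [mul_add]; exact R.add_mem hx hy
  | smul c x _ hx =>
    rw [show c • x = θ c * x from rfl, mul_left_comm]
    exact R.mul_mem (hR c) hx

theorem exists_eq_sum_C_add_mul {r : K⟦X⟧} {a : ℕ} (hr : Associated (X ^ a) r) (f : K⟦X⟧) :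
    ∃ g, f = ∑ i ∈ Finset.range a, C (coeff i f) * X ^ i + r * g := by
  have : r ∣ f - ∑ i ∈ Finset.range a, C (coeff i f) * X ^ i := by
    refine hr.symm.dvd.trans (X_pow_dvd_iff.2 fun m hm => ?_)
    simp [coeff_X_pow, hm]
  obtain ⟨g, hg⟩ := this
  exact ⟨g, by rw [← hg]; ring⟩

/-- If `θ(X)` has order `a > 0`, then `1, X, …, X ^ (a - 1)` generate `K[[X]]` over its subring
`θ(K[[X]])`. -/
theorem exists_eq_sum_map_mul_X_pow (θ : K⟦X⟧ →ₐ[K] K⟦X⟧) {a : ℕ} (ha : 0 < a)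
    (hr : Associated (X ^ a) (θ X)) (f : K⟦X⟧) :
    ∃ h : ℕ → K⟦X⟧, f = ∑ i ∈ Finset.range a, θ (h i) * X ^ i := by
  choose q hq using exists_eq_sum_C_add_mul hr
  -- repeated division by `θ X` yields the coefficients of the wanted series one after another
  let H : K⟦X⟧ → ℕ → K⟦X⟧ := fun f i => mk fun m => coeff i (q^[m] f)
  have hH : ∀ f i, H f i = C (coeff i f) + X * H (q f) i := by
    intro f i
    ext n
    cases n with
    | zero => simp [H]
    | succ n => simp [H, coeff_succ_X_mul]
  have hC : ∀ k : K, θ (C k) = C k := fun k => θ.commutes k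
  let D : K⟦X⟧ → K⟦X⟧ := fun f => f - ∑ i ∈ Finset.range a, θ (H f i) * X ^ i
  have hD : ∀ f, D f = θ X * D (q f) := by
    intro f
    have h1 : ∑ i ∈ Finset.range a, θ (H f i) * X ^ i =
        ∑ i ∈ Finset.range a, C (coeff i f) * X ^ i +
          θ X * ∑ i ∈ Finset.range a, θ (H (q f) i) * X ^ i := by
      rw [Finset.mul_sum, ← Finset.sum_add_distrib]
      refine Finset.sum_congr rfl fun i _ => ?_
      rw [hH f i, map_add, map_mul, hC]
      ring
    have h2 := hq f
    simp only [D]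
    rw [h1]
    linear_combination h2
  have hX : X ∣ θ X := (dvd_pow_self X ha.ne').trans hr.dvd
  have hdvd : ∀ m f, X ^ m ∣ D f := by
    intro m
    induction m with
    | zero => simp
    | succ m ih =>
      intro f
      rw [hD, pow_succ']
      exact mul_dvd_mul hX (ih _)
  refine ⟨H f, sub_eq_zero.1 (?_ : D f = 0)⟩
  ext n
  exact X_pow_dvd_iff.1 (hdvd (n + 1) f) n n.lt_succ_self

theorem finite_of_associated (θ : K⟦X⟧ →ₐ[K] Ambient K) {a b : ℕ} (ha : 0 < a) (hb : 0 < b)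
    (h1 : Associated (X ^ a) (θ X).1) (h2 : Associated (X ^ b) (θ X).2) :
    (θ : K⟦X⟧ →+* Ambient K).Finite := by
  refine finite_of_forall_exists_sum (ι := Fin a ⊕ Fin b) _
    (Sum.elim (fun i => (X ^ (i : ℕ), 0)) (fun j => (0, X ^ (j : ℕ)))) fun f => ?_
  obtain ⟨c, hc⟩ := exists_eq_sum_map_mul_X_pow ((AlgHom.fst K K⟦X⟧ K⟦X⟧).comp θ) ha h1 f.1
  obtain ⟨e, he⟩ := exists_eq_sum_map_mul_X_pow ((AlgHom.snd K K⟦X⟧ K⟦X⟧).comp θ) hb h2 f.2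
  refine ⟨Sum.elim (fun i => c i) (fun j => e j), ?_⟩
  ext1
  · conv_lhs => rw [hc]
    simp [Fintype.sum_sum_type, Prod.fst_sum, Finset.sum_range]
  · conv_lhs => rw [he]
    simp [Fintype.sum_sum_type, Prod.snd_sum, Finset.sum_range]

/-! ### Rings of parametrized curves -/

namespace Parametrization

variable {n : ℕ} (P : Parametrization K n)

/-- The substitution `K[[x₁, …, xₙ]] → K[[t]] × K[[u]]` whose image is `P.ring`. -/
noncomputable def subst : MvPowerSeries (Fin n) K →ₐ[K] Ambient K :=
  (MvPowerSeries.substAlgHom (R := K) P.hasSubst_φ).prod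
    (MvPowerSeries.substAlgHom (R := K) P.hasSubst_ψ)

theorem mem_ring {x : Ambient K} : x ∈ P.ring ↔ ∃ F, P.subst F = x := Iff.rfl

theorem algebraMap_mem_ring (k : K) : algebraMap K (Ambient K) k ∈ P.ring :=
  P.mem_ring.2 ⟨algebraMap _ _ k, P.subst.commutes k⟩

theorem subst_X (i : Fin n) : P.subst (MvPowerSeries.X i) = (P.φ i, P.ψ i) := by
  ext1
  · exact MvPowerSeries.substAlgHom_X P.hasSubst_φ i
  · exact MvPowerSeries.substAlgHom_X P.hasSubst_ψ i

theorem generator_mem_ring (i : Fin n) : (P.φ i, P.ψ i) ∈ P.ring :=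
  P.mem_ring.2 ⟨_, P.subst_X i⟩

theorem constantCoeff_substAlgHom {a : Fin n → K⟦X⟧} (ha : ∀ i, constantCoeff (a i) = 0)
    (F : MvPowerSeries (Fin n) K) :
    constantCoeff (MvPowerSeries.substAlgHom (R := K)
      (MvPowerSeries.hasSubst_of_constantCoeff_zero ha) F) = MvPowerSeries.constantCoeff F := by
  have h : F = algebraMap K _ (MvPowerSeries.constantCoeff F) +
      (F - algebraMap K _ (MvPowerSeries.constantCoeff F)) := by ring
  conv_lhs => rw [h]
  rw [map_add, AlgHom.commutes, map_add, MvPowerSeries.coe_substAlgHom]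
  have := MvPowerSeries.constantCoeff_subst_eq_zero
    (MvPowerSeries.hasSubst_of_constantCoeff_zero ha) ha
    (f := F - algebraMap K _ (MvPowerSeries.constantCoeff F)) (by
      simp [MvPowerSeries.algebraMap_apply])
  erw [this]
  simp

theorem constantCoeff_subst_fst (F : MvPowerSeries (Fin n) K) :
    constantCoeff (P.subst F).1 = MvPowerSeries.constantCoeff F :=
  constantCoeff_substAlgHom P.φ_zero F

theorem constantCoeff_subst_snd (F : MvPowerSeries (Fin n) K) :
    constantCoeff (P.subst F).2 = MvPowerSeries.constantCoeff F :=
  constantCoeff_substAlgHom P.ψ_zero F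

/-- Power series without constant term can be evaluated at elements of the maximal ideal of
`P.ring`. -/
theorem exists_algHom {r : Ambient K} (hr : r ∈ P.ring) (h0 : constantCoeff r.1 = 0) :
    ∃ θ : K⟦X⟧ →ₐ[K] Ambient K, θ X = r ∧ ∀ h, θ h ∈ P.ring := by
  obtain ⟨F, rfl⟩ := P.mem_ring.1 hr
  rw [constantCoeff_subst_fst] at h0
  have hF : PowerSeries.HasSubst F := PowerSeries.HasSubst.of_constantCoeff_zero h0
  refine ⟨P.subst.comp (PowerSeries.substAlgHom hF), ?_, fun h => P.mem_ring.2 ⟨_, rfl⟩⟩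
  rw [AlgHom.comp_apply, PowerSeries.substAlgHom_X]

theorem X_pow_dvd_substAlgHom {a : Fin n → K⟦X⟧} (ha : ∀ i, constantCoeff (a i) = 0) {N : ℕ}
    {F : MvPowerSeries (Fin n) K} (hF : (N : ℕ∞) ≤ F.order) :
    X ^ N ∣ MvPowerSeries.substAlgHom (R := K)
      (MvPowerSeries.hasSubst_of_constantCoeff_zero ha) F := by
  rw [X_pow_dvd_iff_le_order, order_eq_order, MvPowerSeries.coe_substAlgHom]
  refine le_trans ?_ (MvPowerSeries.le_order_subst
    (MvPowerSeries.hasSubst_of_constantCoeff_zero ha) F)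
  have h1 : (1 : ℕ∞) ≤ ⨅ i, MvPowerSeries.order (a i) :=
    le_iInf fun i => MvPowerSeries.one_le_order_iff_constCoeff_eq_zero.2 (ha i)
  calc (N : ℕ∞) = 1 * N := (one_mul _).symm
    _ ≤ _ := mul_le_mul' h1 hF

/-- A subring that contains `K`, the generators of `P.ring` and all elements of large value
contains `P.ring`: modulo elements of large value, a power series is a polynomial. -/
theorem ring_le {S : Subring (Ambient K)} (hK : ∀ k, algebraMap K (Ambient K) k ∈ S)
    (hP : ∀ i, (P.φ i, P.ψ i) ∈ S) {γ : ℕ × ℕ} (hγ : ∀ b, mono K γ ∣ b → b ∈ S) : P.ring ≤ S := by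
  intro x hx
  obtain ⟨F, rfl⟩ := P.mem_ring.1 hx
  set N := max γ.1 γ.2 with hN
  set G : MvPolynomial (Fin n) K := MvPowerSeries.truncTotal N F with hG
  have hpoly : ∀ G : MvPolynomial (Fin n) K, P.subst (G : MvPowerSeries (Fin n) K) ∈ S := by
    intro G
    induction G using MvPolynomial.induction_on with
    | C k =>
      rw [MvPolynomial.coe_C]
      have := P.subst.commutes k
      rw [MvPowerSeries.algebraMap_apply] at this
      exact (by simpa using this : P.subst (MvPowerSeries.C k) = _) ▸ hK k
    | add p q hp hq => rw [MvPolynomial.coe_add, map_add]; exact S.add_mem hp hq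
    | mul_X p i hp =>
      rw [MvPolynomial.coe_mul, map_mul, MvPolynomial.coe_X, P.subst_X]
      exact S.mul_mem hp (hP i)
  have hord : (N : ℕ∞) ≤ (F - (G : MvPowerSeries (Fin n) K)).order := by
    refine MvPowerSeries.le_order fun d hd => ?_
    rw [map_sub, MvPolynomial.coeff_coe, MvPowerSeries.coeff_truncTotal _ (by exact_mod_cast hd),
      sub_self]
  have hrest : P.subst (F - G) ∈ S := hγ _ (mono_dvd.2
    ⟨(pow_dvd_pow X (le_max_left γ.1 γ.2)).trans (X_pow_dvd_substAlgHom P.φ_zero hord),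
      (pow_dvd_pow X (le_max_right γ.1 γ.2)).trans (X_pow_dvd_substAlgHom P.ψ_zero hord)⟩)
  have : P.subst F = P.subst (F - G) + P.subst G := by rw [← map_add, sub_add_cancel]
  exact this ▸ S.add_mem hrest (hpoly G)

end Parametrization

/-! ### Lifting a conductor along a thickening -/

/-- A subring that exhausts a ring modulo the square of a principal ideal exhausts it modulo all
powers of that ideal. -/
theorem exists_pow_dvd_sub {B : Type*} [CommRing B] {T : Subring B} {ϖ : B}
    (h : ∀ b, ∃ t ∈ T, ϖ ^ 2 ∣ b - t) (m : ℕ) (b : B) : ∃ t ∈ T, ϖ ^ m ∣ b - t := by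
  induction m generalizing b with
  | zero => exact ⟨0, T.zero_mem, by simp⟩
  | succ m ih =>
    obtain ⟨t, ht, b', hb'⟩ := ih b
    obtain ⟨t', ht', e, he⟩ := h b'
    obtain ⟨p, hp, e', he'⟩ := h ϖ
    -- `p` is `ϖ` times an element congruent to `1` modulo `ϖ`
    have hp' : p = ϖ * (1 - ϖ * e') := by linear_combination (-1 : B) * he'
    obtain ⟨w, hw⟩ : ϖ ∣ (1 - ϖ * e') ^ m - 1 ^ m :=
      (Dvd.intro (-e') (by ring)).trans (sub_dvd_pow_sub_pow _ _ m)
    refine ⟨t + t' * p ^ m, T.add_mem ht (T.mul_mem ht' (T.pow_mem hp m)), ϖ * e - t' * w, ?_⟩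
    rw [hp', mul_pow, pow_succ]
    rw [one_pow] at hw
    linear_combination hb' + ϖ ^ m * he - ϖ ^ m * t' * hw

/-- Let `S` be an Arf ring such that every element of value at least `c` is congruent to an element
of `S` modulo elements of value at least `c + (2, 2)`. Then `S` contains every element of value at
least `c`, provided it is a module over a power series ring over which `K[[t]] × K[[u]]` is
finite. Indeed `S` has an element `y` of value `c`, and the ring `y⁻¹ S(c)` is everything modulo
`(t², u²)`, hence modulo all powers of `(t, u)`. -/
theorem IsArf.mem_of_mono_dvd {S : Subring (Ambient K)} (hS : IsArf S) {c : ℕ × ℕ}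
    (h : ∀ b, mono K c ∣ b → b ∈ thicken S (Ideal.span {mono K (c + (2, 2))}))
    {θ : K⟦X⟧ →ₐ[K] Ambient K} (hθ : (θ : K⟦X⟧ →+* Ambient K).Finite) (hθS : ∀ f, θ f ∈ S) {N : ℕ}
    (hN : θ X ∣ mono K (1, 1) ^ N) {b : Ambient K} (hb : mono K c ∣ b) : b ∈ S := by
  have h2 : mono K (c + (2, 2)) = mono K c * mono K (1, 1) ^ 2 := by
    rw [mono_add]; congr 1; simp [mono]
  obtain ⟨y, hy, hyc⟩ := mem_thicken.1 (h _ dvd_rfl)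
  rw [Ideal.mem_span_singleton, h2] at hyc
  obtain ⟨w, hw⟩ := hyc
  have hu : IsUnit (1 - mono K (1, 1) ^ 2 * w) := by
    rw [Prod.isUnit_iff]
    constructor <;> rw [isUnit_iff_constantCoeff] <;> simp [mono]
  obtain ⟨u, hu⟩ := hu
  have hyu : y = mono K c * u := by rw [hu]; linear_combination (-1 : Ambient K) * hw
  have hc : mono K c ∈ nonZeroDivisors (Ambient K) := by
    rw [mem_nonZeroDivisors_iff]; simp [mono]
  obtain ⟨hy1, hy2⟩ := mem_nonZeroDivisors_iff.1
    (hyu ▸ mul_mem hc u.isUnit.mem_nonZeroDivisors : y ∈ nonZeroDivisors (Ambient K))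
  set T := blowup hy (isArf_iff.1 hS y hy hy1 hy2) with hT
  have hT2 : ∀ b, ∃ t ∈ T, mono K (1, 1) ^ 2 ∣ b - t := by
    intro b
    obtain ⟨z, hz, hzb⟩ := mem_thicken.1 (h (mono K c * b) (Dvd.intro _ rfl))
    rw [Ideal.mem_span_singleton, h2] at hzb
    obtain ⟨w', hw'⟩ := hzb
    have huu : (u : Ambient K) * ((u⁻¹ : (Ambient K)ˣ) : Ambient K) = 1 := u.mul_inv
    refine ⟨(u⁻¹ : (Ambient K)ˣ) * (b - mono K (1, 1) ^ 2 * w'), mem_blowup.2 ?_,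
      (u⁻¹ : (Ambient K)ˣ) * (w' - w * b), ?_⟩
    · have : y * ((u⁻¹ : (Ambient K)ˣ) * (b - mono K (1, 1) ^ 2 * w')) = z := by
        rw [hyu]
        linear_combination (mono K c * (b - mono K (1, 1) ^ 2 * w')) * huu + hw'
      rwa [this]
    · linear_combination (-b) * huu + ((u⁻¹ : (Ambient K)ˣ) : Ambient K) * b * hu
  have hTtop : ∀ b, b ∈ T := forall_mem_of_forall_dvd_sub hθ (ϖ := X)
    (Ideal.mem_jacobson_bot.2 fun f => by rw [isUnit_iff_constantCoeff]; simp)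
    (fun f => mem_blowup.2 (S.mul_mem hy (hθS f))) fun b => by
      obtain ⟨t, ht, htb⟩ := exists_pow_dvd_sub hT2 N b
      exact ⟨t, ht, hN.trans htb⟩
  obtain ⟨v, rfl⟩ := hb
  have := mem_blowup.1 (hTtop ((u⁻¹ : (Ambient K)ˣ) * v))
  rwa [hyu, mul_assoc, Units.mul_inv_cancel_left] at this

/-! ### Curves with two branches -/

namespace Parametrization

variable {n : ℕ} {P : Parametrization K n}

theorem constantCoeff_snd_eq_fst {r : Ambient K} (hr : r ∈ P.ring) :
    constantCoeff r.2 = constantCoeff r.1 := by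
  obtain ⟨F, rfl⟩ := P.mem_ring.1 hr
  rw [constantCoeff_subst_snd, constantCoeff_subst_fst]

/-- If `P.ring` contains a non-unit of finite value, then `K[[t]] × K[[u]]` is finite over a power
series ring contained in `P.ring`. -/
theorem exists_finite_algHom {r : Ambient K} (hr : r ∈ P.ring) (h1 : r.1 ≠ 0) (h2 : r.2 ≠ 0)
    (h0 : constantCoeff r.1 = 0) :
    ∃ θ : K⟦X⟧ →ₐ[K] Ambient K, θ X = r ∧ (∀ h, θ h ∈ P.ring) ∧
      (θ : K⟦X⟧ →+* Ambient K).Finite := by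
  obtain ⟨θ, hθ, hθP⟩ := P.exists_algHom hr h0
  have h0' : constantCoeff r.2 = 0 := constantCoeff_snd_eq_fst hr ▸ h0
  have hpos : ∀ {f : K⟦X⟧} {a : ℕ}, constantCoeff f = 0 → f.order = a → 0 < a := by
    intro f a hf ha
    have h := one_le_order_iff_constCoeff_eq_zero.2 hf
    rw [ha] at h
    exact_mod_cast h
  obtain ⟨a, ha⟩ := exists_order_eq h1
  obtain ⟨b, hb⟩ := exists_order_eq h2
  refine ⟨θ, hθ, hθP, finite_of_associated θ (hpos h0 ha) (hpos h0' hb) ?_ ?_⟩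
  · rw [hθ]; exact order_eq_coe_iff.1 ha
  · rw [hθ]; exact order_eq_coe_iff.1 hb

theorem IsTwoBranchCurve.exists_nonunit (hP : P.IsTwoBranchCurve) :
    ∃ r ∈ P.ring, r.1 ≠ 0 ∧ r.2 ≠ 0 ∧ constantCoeff r.1 = 0 := by
  obtain ⟨r, hr, hr0, hr1⟩ := hP.fraction (1, 0)
  rw [mem_nonZeroDivisors_iff] at hr0
  refine ⟨r, hr, hr0.1, hr0.2, ?_⟩
  simpa using (constantCoeff_snd_eq_fst hr1).symm

/-- The ring of a curve with two branches contains all elements of large value. -/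
theorem IsTwoBranchCurve.exists_mono_dvd_imp_mem (hP : P.IsTwoBranchCurve) :
    ∃ γ : ℕ × ℕ, ∀ b, mono K γ ∣ b → b ∈ P.ring := by
  obtain ⟨r, hr, h1, h2, h0⟩ := hP.exists_nonunit
  obtain ⟨θ, -, hθP, hfin⟩ := exists_finite_algHom hr h1 h2 h0
  obtain ⟨d, -, hd0, hd⟩ := exists_common_denominator hfin hθP hP.fraction
  rw [mem_nonZeroDivisors_iff] at hd0
  obtain ⟨a, ha⟩ := exists_order_eq hd0.1
  obtain ⟨b, hb⟩ := exists_order_eq hd0.2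
  refine ⟨(a, b), fun x hx => ?_⟩
  rw [mono_dvd] at hx
  obtain ⟨w, rfl⟩ : d ∣ x := (prod_dvd_iff).2
    ⟨(order_eq_coe_iff.1 ha).dvd_iff_dvd_left.1 hx.1,
      (order_eq_coe_iff.1 hb).dvd_iff_dvd_left.1 hx.2⟩
  exact hd w

/-- Conversely, a curve has two branches if its ring contains a non-unit of finite value and its
Arf closure contains all elements of large value, since the Arf closure consists of fractions. -/
theorem isTwoBranchCurve_of_arfClosure {r : Ambient K} (hr : r ∈ P.ring) (h1 : r.1 ≠ 0)
    (h2 : r.2 ≠ 0) (h0 : constantCoeff r.1 = 0) {γ : ℕ × ℕ}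
    (hγ : ∀ b, mono K γ ∣ b → b ∈ arfClosure P.ring) : P.IsTwoBranchCurve where
  integral f := by
    obtain ⟨θ, -, hθP, hfin⟩ := exists_finite_algHom hr h1 h2 h0
    obtain ⟨p, hp, hpf⟩ := hfin.to_isIntegral f
    let θ' : K⟦X⟧ →+* P.ring := (θ : K⟦X⟧ →+* Ambient K).codRestrict P.ring hθP
    exact ⟨p.map θ', hp.map θ', by rw [Polynomial.eval₂_map]; exact hpf⟩
  fraction f := by
    have hle : arfClosure P.ring ≤ fractions P.ring :=
      arfClosure_le (isArf_fractions _) (le_fractions _)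
    exact mem_fractions.1 (mem_fractions_of_mul_mem (hle (hγ _ dvd_rfl))
      (mem_nonZeroDivisors_iff.2 (by simp [mono])) (hle (hγ _ (Dvd.intro f rfl))))

/-- If `X ^ (c[1] + 2)` divided all components of the parametrization in the first branch, then in
this branch the elements of the Arf closure would be constant modulo `X ^ (c[1] + 2)`. -/
theorem exists_not_X_pow_dvd_φ {c : ℕ × ℕ} (hc : ∀ b, mono K c ∣ b → b ∈ arfClosure P.ring) :
    ∃ i, ¬ X ^ (c.1 + 2) ∣ P.φ i := by
  by_contra! h
  have hle := arfClosure_le (isArf_thicken_constants_fst (K := K) (c.1 + 2)) (P.ring_le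
    (fun k => le_thicken _ _ ⟨k, rfl⟩)
    (fun i => mem_thicken_of_mem_ideal _ (by
      rw [Ideal.mem_comap, Ideal.mem_span_singleton]; exact h i))
    (γ := (c.1 + 2, 0)) (fun b hb => mem_thicken_of_mem_ideal _ (by
      rw [Ideal.mem_comap, Ideal.mem_span_singleton]; exact (mono_dvd.1 hb).1)))
  obtain ⟨_, ⟨k, rfl⟩, hk⟩ := mem_thicken.1
    (hle (hc (mono K (c.1 + 1, c.2)) (mono_dvd_mono ⟨by simp, le_rfl⟩)))
  rw [Ideal.mem_comap, Ideal.mem_span_singleton] at hk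
  exact not_X_pow_dvd_X_pow_sub_C _ _ hk

theorem exists_not_X_pow_dvd_ψ {c : ℕ × ℕ} (hc : ∀ b, mono K c ∣ b → b ∈ arfClosure P.ring) :
    ∃ i, ¬ X ^ (c.2 + 2) ∣ P.ψ i := by
  by_contra! h
  have hle := arfClosure_le (isArf_thicken_constants_snd (K := K) (c.2 + 2)) (P.ring_le
    (fun k => le_thicken _ _ ⟨k, rfl⟩)
    (fun i => mem_thicken_of_mem_ideal _ (by
      rw [Ideal.mem_comap, Ideal.mem_span_singleton]; exact h i))
    (γ := (0, c.2 + 2)) (fun b hb => mem_thicken_of_mem_ideal _ (by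
      rw [Ideal.mem_comap, Ideal.mem_span_singleton]; exact (mono_dvd.1 hb).2)))
  obtain ⟨_, ⟨k, rfl⟩, hk⟩ := mem_thicken.1
    (hle (hc (mono K (c.1, c.2 + 1)) (mono_dvd_mono ⟨le_rfl, by simp⟩)))
  rw [Ideal.mem_comap, Ideal.mem_span_singleton] at hk
  exact not_X_pow_dvd_X_pow_sub_C _ _ hk

/-! ### Truncation -/

theorem mono_dvd_sub_truncate (P : Parametrization K n) (c : ℕ × ℕ) (i : Fin n) :
    mono K (c + (2, 2)) ∣ (P.φ i, P.ψ i) - ((P.truncate c).φ i, (P.truncate c).ψ i) :=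
  mono_dvd.2 ⟨X_pow_dvd_sub_trunc _ _, X_pow_dvd_sub_trunc _ _⟩

theorem exists_nonunit_of_generators {i j : Fin n} (hi : P.φ i ≠ 0) (hj : P.ψ j ≠ 0) :
    ∃ r ∈ P.ring, r.1 ≠ 0 ∧ r.2 ≠ 0 ∧ constantCoeff r.1 = 0 := by
  by_cases hi' : P.ψ i = 0
  · by_cases hj' : P.φ j = 0
    · exact ⟨_, P.ring.add_mem (P.generator_mem_ring i) (P.generator_mem_ring j),
        by simpa [hj'] using hi, by simpa [hi'] using hj, by simp [P.φ_zero]⟩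
    · exact ⟨_, P.generator_mem_ring j, hj', hj, P.φ_zero j⟩
  · exact ⟨_, P.generator_mem_ring i, hi, hi', P.φ_zero i⟩

theorem exists_nonunit_truncate {c : ℕ × ℕ}
    (hc : ∀ b, mono K c ∣ b → b ∈ arfClosure P.ring) :
    ∃ r ∈ (P.truncate c).ring, r.1 ≠ 0 ∧ r.2 ≠ 0 ∧ constantCoeff r.1 = 0 := by
  obtain ⟨i, hi⟩ := exists_not_X_pow_dvd_φ hc
  obtain ⟨j, hj⟩ := exists_not_X_pow_dvd_ψ hc
  refine exists_nonunit_of_generators (i := i) (j := j) (fun h => hi ?_) (fun h => hj ?_)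
  · have := (mono_dvd.1 (P.mono_dvd_sub_truncate c i)).1
    simpa [h] using this
  · have := (mono_dvd.1 (P.mono_dvd_sub_truncate c j)).2
    simpa [h] using this

/-- The Arf closure of the truncated curve still contains every element of value at least `c`. -/
theorem mem_arfClosure_truncate {c : ℕ × ℕ}
    (hc : ∀ b, mono K c ∣ b → b ∈ arfClosure P.ring) {b : Ambient K} (hb : mono K c ∣ b) :
    b ∈ arfClosure (P.truncate c).ring := by
  obtain ⟨r, hr, h1, h2, h0⟩ := exists_nonunit_truncate hc
  obtain ⟨θ, hθ, hθP, hfin⟩ := exists_finite_algHom hr h1 h2 h0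
  have hle := le_arfClosure (P.truncate c).ring
  have hK : ∀ k, algebraMap K (Ambient K) k ∈ arfClosure (P.truncate c).ring := fun k =>
    hle ((P.truncate c).algebraMap_mem_ring k)
  have h0' : constantCoeff r.2 = 0 := constantCoeff_snd_eq_fst hr ▸ h0
  have hs : mono K (c + (2, 2)) ∣ r ^ max (c.1 + 2) (c.2 + 2) := mono_dvd.2
    ⟨(pow_dvd_pow X (le_max_left _ _)).trans (pow_dvd_pow_of_dvd (X_dvd_iff.2 h0) _),
      (pow_dvd_pow X (le_max_right _ _)).trans (pow_dvd_pow_of_dvd (X_dvd_iff.2 h0') _)⟩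
  have hE := isArf_thicken (isArf_arfClosure _) hK (d := c + (2, 2))
    (Subring.pow_mem _ (hle hr) (max (c.1 + 2) (c.2 + 2))) (pow_ne_zero _ h1) (pow_ne_zero _ h2) hs
  have hPE : P.ring ≤ thicken (arfClosure (P.truncate c).ring)
      (Ideal.span {mono K (c + (2, 2))}) :=
    P.ring_le (fun k => le_thicken _ _ (hK k))
      (fun i => mem_thicken.2 ⟨_, hle ((P.truncate c).generator_mem_ring i),
        Ideal.mem_span_singleton.2 (P.mono_dvd_sub_truncate c i)⟩)
      (fun b hb => mem_thicken_of_mem_ideal _ (Ideal.mem_span_singleton.2 hb))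
  obtain ⟨a, ha⟩ := exists_order_eq h1
  obtain ⟨a', ha'⟩ := exists_order_eq h2
  refine (isArf_arfClosure _).mem_of_mono_dvd
    (fun b hb => arfClosure_le hE hPE (hc b hb)) hfin (fun f => hle (hθP f)) (N := max a a') ?_ hb
  rw [hθ, prod_dvd_iff]
  constructor
  · simpa [mono] using (order_eq_coe_iff.1 ha).symm.dvd.trans (pow_dvd_pow X (le_max_left a a'))
  · simpa [mono] using (order_eq_coe_iff.1 ha').symm.dvd.trans (pow_dvd_pow X (le_max_right a a'))

end Parametrization

end AlgebroidCurve

theorem corollary4p2 {K : Type*} [Field K] {n : ℕ} (P : AlgebroidCurve.Parametrization K n)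
    (hP : P.IsTwoBranchCurve) :
    ∃ c : ℕ × ℕ,
      AlgebroidCurve.IsConductor
        (AlgebroidCurve.valueSet (AlgebroidCurve.arfClosure P.ring)) c ∧
      (P.truncate c).IsTwoBranchCurve ∧
      AlgebroidCurve.arfClosure P.ring = AlgebroidCurve.arfClosure (P.truncate c).ring := by
  open AlgebroidCurve AlgebroidCurve.Parametrization in
  obtain ⟨γ, hγ⟩ := hP.exists_mono_dvd_imp_mem
  have hγA : ∀ b, mono K γ ∣ b → b ∈ arfClosure P.ring := fun b hb => le_arfClosure _ (hγ b hb)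
  have hKA : ∀ k, algebraMap K (Ambient K) k ∈ arfClosure P.ring := fun k =>
    le_arfClosure _ (P.algebraMap_mem_ring k)
  obtain ⟨c, hc⟩ := exists_isConductor
    (fun α hα β hβ => inf_mem_valueSet (S := arfClosure P.ring) hα hβ) (γ := γ) fun β hβ =>
      mem_valueSet.2 ⟨mono K β, hγA _ (mono_dvd_mono hβ), Associated.refl _, Associated.refl _⟩
  have hcA : ∀ b, mono K c ∣ b → b ∈ arfClosure P.ring := fun b hb =>
    mem_of_mono_dvd hKA hγA hc.1 hb
  have hcQ : ∀ b, mono K c ∣ b → b ∈ arfClosure (P.truncate c).ring := fun b hb =>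
    mem_arfClosure_truncate hcA hb
  have hdvd : ∀ i, mono K c ∣ (P.φ i, P.ψ i) - ((P.truncate c).φ i, (P.truncate c).ψ i) :=
    fun i => (mono_dvd_mono (by simp)).trans (P.mono_dvd_sub_truncate c i)
  obtain ⟨r, hr, h1, h2, h0⟩ := exists_nonunit_truncate hcA
  refine ⟨c, hc, isTwoBranchCurve_of_arfClosure hr h1 h2 h0 hcQ, le_antisymm ?_ ?_⟩
  · refine arfClosure_le (isArf_arfClosure _) (P.ring_le
      (fun k => le_arfClosure _ ((P.truncate c).algebraMap_mem_ring k)) (fun i => ?_) hcQ)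
    have := add_mem (hcQ _ (hdvd i)) (le_arfClosure _ ((P.truncate c).generator_mem_ring i))
    rwa [sub_add_cancel] at this
  · refine arfClosure_le (isArf_arfClosure _) ((P.truncate c).ring_le hKA (fun i => ?_) hcA)
    have := sub_mem (le_arfClosure _ (P.generator_mem_ring i)) (hcA _ (hdvd i))
    rwa [sub_sub_cancel] at this
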